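/- Consider a matching market in which agents of type $H$ and of type $E$ arrive according to independent Poisson processes with rates $\lambda_H>0$ and $\lambda_E>0$. Every agent owns an item, and an agent of type $T\in\{H,E\}$ finds the item of any given other agent compatible with probability $p_T$, independently over all ordered pairs, where $p_E\in(0,1]$ is fixed and $p_H\in(0,1]$. Let $d\ge 1$ be an integer that does not depend on $p_H$. Initially there are $d$ altruistic agents, who give an item without receiving one; at all times there are exactly $d$ bridge agents, that is, agents who are altruistic or have received an item, and who have not yet given their own. Under the policy ChainMatch($d$), when an agent arrives who finds none of the bridge agents' items compatible, she joins the waiting agents. Otherwise one of the bridge agents with a compatible item, chosen uniformly at random, gives it to her, and a chain-segment starts: as long as some waiting agent finds the item of the last agent of the chain-segment compatible, one of these agents, chosen uniformly at random among those of type $H$ if there are any and among those of type $E$ otherwise, receives it, leaves the waiting agents, and becomes the last agent. When this stops, the last agent becomes a bridge agent. The chain-segment is carried out instantaneously, and an agent waits from her arrival until she receives an item. Then for every $p_H\in(0,1]$ the continuous-time Markov chain of the numbers of waiting $H$ and $E$ agents has exactly one stationary distribution, and the average waiting time $w_H=w_H(\lambda_H,\lambda_E,p_H,p_E,d)$ of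 $H$ agents in this steady state satisfies $$\limsup_{p_H\to 0^+} p_H\,w_H\;\le\;\frac{1}{\lambda_H}\ln\!\left(\frac{\lambda_H}{\lambda_E\bigl(1-(1-p_E)^d\bigr)}+1\right).$$ -/

import Mathlib

open scoped unitInterval ENNReal NNReal Topology

noncomputable section

namespace ChainMatching

/-- A coin that shows `true` with probability `p`. -/
def coin (p : I) : PMF Bool :=
  PMF.ofFintype
    (fun b => ((if b then unitInterval.toNNReal p else unitInterval.toNNReal (σ p) : ℝ≥0) : ℝ≥0∞))
    (by
      rw [Fintype.sum_bool, ← ENNReal.coe_add]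
      simp)

/-- `1 - (1 - p) ^ n`: the probability that at least one of `n` independent directed edges, each
present with probability `p`, exists. -/
def someEdge (p : I) (n : ℕ) : I := σ (σ p ^ n)

/-- The law of the numbers `(h', e')` of waiting `H` and `E` agents that are left over by a
chain-segment whose current last agent faces `h` waiting `H` agents and `e` waiting `E` agents.
The last agent finds some `H` agent that can receive from her with probability `1 - (1 - pH) ^ h`;
then an `H` agent is matched, leaves the pool and becomes the last agent. Otherwise she finds some
`E` agent that can receive from her with probability `1 - (1 - pE) ^ e`; then an `E` agent is
matched, leaves the pool and becomes the last agent. Otherwise the chain-segment ends. (The tests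
`0 < h` and `0 < e` are redundant: the coin shows `false` almost surely for an empty pool.) -/
def chainSegment (pH pE : I) (h e : ℕ) : PMF (ℕ × ℕ) :=
  (coin (someEdge pH h)).bind fun bH =>
    if _ : bH = true ∧ 0 < h then chainSegment pH pE (h - 1) e
    else
      (coin (someEdge pE e)).bind fun bE =>
        if _ : bE = true ∧ 0 < e then chainSegment pH pE h (e - 1)
        else PMF.pure (h, e)
termination_by h + e
decreasing_by all_goals omega

/-- The state after an `H` agent arrives at a market with `d` bridge (or altruistic) agents,
`s.1` waiting `H` agents and `s.2` waiting `E` agents. If one of the bridge agents can give to her,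
a chain-segment starts with her; otherwise she joins the waiting agents. -/
def arriveH (pH pE : I) (d : ℕ) (s : ℕ × ℕ) : PMF (ℕ × ℕ) :=
  (coin (someEdge pH d)).bind fun b =>
    if b then chainSegment pH pE s.1 s.2 else PMF.pure (s.1 + 1, s.2)

/-- The state after an `E` agent arrives. -/
def arriveE (pH pE : I) (d : ℕ) (s : ℕ × ℕ) : PMF (ℕ × ℕ) :=
  (coin (someEdge pE d)).bind fun b =>
    if b then chainSegment pH pE s.1 s.2 else PMF.pure (s.1, s.2 + 1)

/-- The rate at which the continuous-time Markov chain of the numbers of waiting `H` and `E` agents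
goes from `s` to `t`. For `s = t` this is the rate of the arrivals that leave the state
unchanged. -/
def rate (lamH lamE : ℝ) (pH pE : I) (d : ℕ) (s t : ℕ × ℕ) : ℝ≥0∞ :=
  ENNReal.ofReal lamH * arriveH pH pE d s t + ENNReal.ofReal lamE * arriveE pH pE d s t

/-- `π` is a steady-state distribution: for every state `t`, the flow into `t` equals the flow out
of `t` (the global balance equations). Arrivals that leave the state `t` unchanged are counted on
both sides, so that the total rate of leaving or staying is `lamH + lamE` in every state. -/
def IsSteadyState (lamH lamE : ℝ) (pH pE : I) (d : ℕ) (π : PMF (ℕ × ℕ)) : Prop :=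
  ∀ t : ℕ × ℕ,
    ∑' s : ℕ × ℕ, π s * rate lamH lamE pH pE d s t = ENNReal.ofReal (lamH + lamE) * π t

/-- The chain-segment seen by one tagged waiting `H` agent: `h` is the number of the other waiting
`H` agents, so that there are `h + 1` waiting `H` agents in all. Whenever an `H` agent is matched,
she is uniformly distributed among the waiting `H` agents. The outcome is `none` if the tagged agent
is matched, and otherwise consists of the numbers of other `H` agents and of `E` agents left. -/
def taggedSegment (pH pE : I) (h e : ℕ) : PMF (Option (ℕ × ℕ)) :=
  (coin (someEdge pH (h + 1))).bind fun bH =>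
    if bH then
      (PMF.uniformOfFintype (Fin (h + 1))).bind fun i =>
        if _ : i = 0 ∨ h = 0 then PMF.pure none
        else taggedSegment pH pE (h - 1) e
    else
      (coin (someEdge pE e)).bind fun bE =>
        if _ : bE = true ∧ 0 < e then taggedSegment pH pE h (e - 1)
        else PMF.pure (some (h, e))
termination_by h + e
decreasing_by all_goals omega

/-- What the arrival of an `H` agent does to a tagged waiting `H` agent and to the others. -/
def taggedArriveH (pH pE : I) (d : ℕ) (s : ℕ × ℕ) : PMF (Option (ℕ × ℕ)) :=
  (coin (someEdge pH d)).bind fun b =>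
    if b then taggedSegment pH pE s.1 s.2 else PMF.pure (some (s.1 + 1, s.2))

/-- What the arrival of an `E` agent does to a tagged waiting `H` agent and to the others. -/
def taggedArriveE (pH pE : I) (d : ℕ) (s : ℕ × ℕ) : PMF (Option (ℕ × ℕ)) :=
  (coin (someEdge pE d)).bind fun b =>
    if b then taggedSegment pH pE s.1 s.2 else PMF.pure (some (s.1, s.2 + 1))

/-- The probability that a tagged `H` agent, who waits together with `s.1` other `H` agents and
`s.2` `E` agents, is still waiting after the next `n` arrivals. Each arrival is of type `H` with
probability `lamH / (lamH + lamE)` and of type `E` with probability `lamE / (lamH + lamE)`. -/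
def stillWaiting (lamH lamE : ℝ) (pH pE : I) (d : ℕ) : ℕ → ℕ × ℕ → ℝ≥0∞
  | 0, _ => 1
  | n + 1, s =>
      ∑' t : ℕ × ℕ,
        (ENNReal.ofReal (lamH / (lamH + lamE)) * taggedArriveH pH pE d s (some t) +
          ENNReal.ofReal (lamE / (lamH + lamE)) * taggedArriveE pH pE d s (some t)) *
          stillWaiting lamH lamE pH pE d n t

/-- The expected time until a tagged waiting `H` agent is matched: she waits for as many arrivals
as it takes until she is matched, and consecutive arrivals are on average `1 / (lamH + lamE)` apart,
independently of the types and edges. -/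
def meanRemainingWait (lamH lamE : ℝ) (pH pE : I) (d : ℕ) (s : ℕ × ℕ) : ℝ≥0∞ :=
  (∑' n : ℕ, stillWaiting lamH lamE pH pE d n s) / ENNReal.ofReal (lamH + lamE)

/-- The average waiting time of `H` agents if the market is distributed according to `π`: an
arriving `H` agent finds the market in a state `s` distributed according to `π`. With probability
`1 - (1 - pH) ^ d` some bridge agent can give to her and she does not wait; otherwise she joins
the `s.1` waiting `H` agents. -/
def waitH (lamH lamE : ℝ) (pH pE : I) (d : ℕ) (π : PMF (ℕ × ℕ)) : ℝ≥0∞ :=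
  ∑' s : ℕ × ℕ, π s *
    (ENNReal.ofReal ((1 - (pH : ℝ)) ^ d) * meanRemainingWait lamH lamE pH pE d s)

end ChainMatching

end

/-!
Let `R h` be the expected number of `H` agents that a chain-segment would match if `h` of them were
waiting and there were no `E` agents; the presence of `E` agents only prolongs the segment. Hence
every segment removes at least `R h` waiting `H` agents on average, and likewise for `E` agents.
Since `R` grows at least linearly, the market satisfies a Foster–Lyapunov drift condition, which
yields a stationary distribution with finite means. It is unique because a single arrival can empty
the market from every state.

In the steady state, the inflow of waiting `H` agents balances their removal by the segments that
`E` agents start: with `a` the probability that an arrival is of type `H` and `c` the probability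
that it is an `E` agent who starts a segment, `c * E[R h] ≤ a`. For small `p = pH` the function `R`
is at least `exp (p * h) - 1` up to vanishing terms, and so by Jensen's inequality
`exp (p * E[h]) - 1` is asymptotically at most `a / c`.

Finally, `λ_H * w_H ≤ E[h]` by Little's law. To see it, follow the agents waiting at some moment in
the steady state: by exchangeability each of them is as good as a tagged one, so the expected number
of those who have waited for more than `n` arrivals is expressed by `stillWaiting n`, and the
difference between `n` and `n + 1` is the expected number of new agents who survive `n` arrivals.
-/

namespace ChainMatching

section Mean

variable {α β : Type*}

/-- The expectation of a nonnegative function of a random variable with law `μ`, as an extended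
nonnegative number, so that no measurability or integrability has to be tracked. -/
noncomputable def mean (μ : PMF α) (f : α → ℝ≥0∞) : ℝ≥0∞ := ∑' x, μ x * f x

theorem mean_pure (a : α) (f : α → ℝ≥0∞) : mean (PMF.pure a) f = f a := by
  classical
  rw [mean, tsum_eq_single a fun b hb => by simp [PMF.pure_apply, hb]]
  simp

theorem mean_bind (μ : PMF α) (κ : α → PMF β) (f : β → ℝ≥0∞) :
    mean (μ.bind κ) f = mean μ fun x => mean (κ x) f := by
  simp only [mean, PMF.bind_apply, ← ENNReal.tsum_mul_right, ← ENNReal.tsum_mul_left]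
  rw [ENNReal.tsum_comm]
  simp only [mul_assoc]

theorem mean_uniformOfFintype [Fintype α] [Nonempty α] (f : α → ℝ≥0∞) :
    mean (PMF.uniformOfFintype α) f = (Fintype.card α : ℝ≥0∞)⁻¹ * ∑ x, f x := by
  simp only [mean, PMF.uniformOfFintype_apply, tsum_fintype, Finset.mul_sum]

theorem mean_mono (μ : PMF α) {f g : α → ℝ≥0∞} (h : ∀ x, f x ≤ g x) : mean μ f ≤ mean μ g :=
  ENNReal.tsum_le_tsum fun x => mul_le_mul_right (h x) _

theorem mean_add (μ : PMF α) (f g : α → ℝ≥0∞) :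
    (mean μ fun x => f x + g x) = mean μ f + mean μ g := by
  simp only [mean, mul_add, ENNReal.tsum_add]

theorem mean_tsum {ι : Type*} (μ : PMF α) (f : ι → α → ℝ≥0∞) :
    (mean μ fun x => ∑' i, f i x) = ∑' i, mean μ (f i) := by
  simp only [mean, ← ENNReal.tsum_mul_left]
  exact ENNReal.tsum_comm

theorem mean_const_mul (μ : PMF α) (c : ℝ≥0∞) (f : α → ℝ≥0∞) :
    (mean μ fun x => c * f x) = c * mean μ f := by
  simp only [mean, ← ENNReal.tsum_mul_left, mul_left_comm]

theorem mean_pi_single [DecidableEq α] (μ : PMF α) (t : α) : mean μ (Pi.single t 1) = μ t := by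
  rw [mean, tsum_eq_single t fun s hs => by simp [hs]]
  simp

theorem mean_option_elim (μ : PMF (Option α)) (f : α → ℝ≥0∞) :
    (mean μ fun o => o.elim 0 f) = ∑' x, μ (some x) * f x :=
  ((Option.some_injective α).tsum_eq (f := fun o => μ o * o.elim 0 f) fun o ho => by
    cases o with
    | none => simp at ho
    | some x => exact ⟨x, rfl⟩).symm

theorem mean_const (μ : PMF α) (c : ℝ≥0∞) : (mean μ fun _ => c) = c := by
  simp only [mean, ENNReal.tsum_mul_right, μ.tsum_coe, one_mul]

theorem one_le_sum_add_mean_div (μ : PMF α) {W : α → ℝ≥0∞} {c : ℝ≥0∞} (hc₀ : c ≠ 0)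
    (hc : c ≠ ∞) {F : Finset α} (hF : ∀ s ∉ F, c ≤ W s) :
    1 ≤ ∑ s ∈ F, μ s + mean μ W / c := by
  classical
  have hpoint (s : α) : 1 ≤ (if s ∈ F then 1 else 0) + c⁻¹ * W s := by
    split_ifs with hs
    · exact le_self_add
    · rw [zero_add, ← ENNReal.inv_mul_cancel hc₀ hc]
      gcongr
      exact hF s hs
  have hsum : (mean μ fun s => if s ∈ F then 1 else 0) = ∑ s ∈ F, μ s := by
    rw [mean, tsum_eq_sum (s := F) fun s hs => by simp [hs]]
    exact Finset.sum_congr rfl fun s hs => by simp [hs]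
  calc 1 = mean μ fun _ => 1 := (mean_const μ 1).symm
    _ ≤ mean μ fun s => (if s ∈ F then 1 else 0) + c⁻¹ * W s := mean_mono μ hpoint
    _ = ∑ s ∈ F, μ s + mean μ W / c := by
      rw [mean_add, mean_const_mul, hsum, mul_comm, div_eq_mul_inv]

theorem eq_of_le_of_tsum_le {f g : α → ℝ≥0∞} (hle : ∀ x, f x ≤ g x)
    (hg : ∑' x, g x ≤ ∑' x, f x) (hf : ∑' x, f x ≠ ∞) : f = g := by
  by_contra hne
  obtain ⟨x, hx⟩ := Function.ne_iff.1 hne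
  exact (ENNReal.tsum_lt_tsum hf hle ((hle x).lt_of_ne hx)).not_ge hg

theorem pmf_eq_of_le {μ ν : PMF α} (h : ∀ x, μ x ≤ ν x) : μ = ν :=
  DFunLike.coe_injective <|
    eq_of_le_of_tsum_le h (by rw [μ.tsum_coe, ν.tsum_coe]) μ.tsum_coe_ne_top

end Mean

section StationaryDistribution

variable {α : Type*} {K : α → PMF α}

theorem tsum_inf_mul_kernel {π ν : PMF α} (hπ : π.bind K = π) (hν : ν.bind K = ν) :
    (fun t => ∑' s, (π s ⊓ ν s) * K s t) = fun t => π t ⊓ ν t := by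
  have hmass : ∑' t, ∑' s, (π s ⊓ ν s) * K s t = ∑' s, π s ⊓ ν s := by
    rw [ENNReal.tsum_comm]
    simp only [ENNReal.tsum_mul_left, PMF.tsum_coe, mul_one]
  have hfin : ∑' s, π s ⊓ ν s ≠ ∞ :=
    ne_top_of_le_ne_top π.tsum_coe_ne_top (ENNReal.tsum_le_tsum fun s => inf_le_left)
  refine eq_of_le_of_tsum_le (fun t => le_inf ?_ ?_) hmass.ge (hmass ▸ hfin)
  · rw [← DFunLike.congr_fun hπ t, PMF.bind_apply]
    gcongr
    exact inf_le_left
  · rw [← DFunLike.congr_fun hν t, PMF.bind_apply]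
    gcongr
    exact inf_le_right

/-- The minimum of two stationary distributions is invariant. At `z` it agrees with the smaller
one, and since every state feeds into `z`, it agrees with that one everywhere. -/
theorem stationary_unique {z : α} (hz : ∀ s, K s z ≠ 0) {π ν : PMF α}
    (hπ : π.bind K = π) (hν : ν.bind K = ν) : π = ν := by
  wlog hle : π z ≤ ν z generalizing π ν
  · exact (this hν hπ (le_of_not_ge hle)).symm
  have hflow : ∑' s, π s * K s z = ∑' s, (π s ⊓ ν s) * K s z := by
    rw [congrFun (tsum_inf_mul_kernel hπ hν) z, inf_of_le_left hle, ← PMF.bind_apply, hπ]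
  have hfin : ∑' s, (π s ⊓ ν s) * K s z ≠ ∞ := by
    rw [congrFun (tsum_inf_mul_kernel hπ hν) z]
    exact ne_top_of_le_ne_top (π.apply_ne_top z) inf_le_left
  have hflux := eq_of_le_of_tsum_le (fun s => mul_le_mul_left inf_le_left (K s z)) hflow.le hfin
  refine pmf_eq_of_le fun s => inf_eq_left.1 ?_
  exact (ENNReal.mul_left_inj (hz s) ((K s).apply_ne_top z)).1 (congrFun hflux s)

/-- The law at time `n` of the Markov chain with kernel `K` and initial law `μ`. -/
noncomputable def law (K : α → PMF α) (μ : PMF α) : ℕ → PMF α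
  | 0 => μ
  | n + 1 => (law K μ n).bind K

/-- The average of the laws at times `0, …, n`; its limit points are the candidates for a
stationary distribution. -/
noncomputable def cesaro (K : α → PMF α) (μ : PMF α) (n : ℕ) : PMF α :=
  (PMF.uniformOfFintype (Fin (n + 1))).bind fun k => law K μ k

theorem mean_cesaro (K : α → PMF α) (μ : PMF α) (n : ℕ) (f : α → ℝ≥0∞) :
    mean (cesaro K μ n) f =
      ((n + 1 : ℕ) : ℝ≥0∞)⁻¹ * ∑ k ∈ Finset.range (n + 1), mean (law K μ k) f := by
  rw [cesaro, mean_bind, mean_uniformOfFintype, Fintype.card_fin,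
    Fin.sum_univ_eq_sum_range fun k => mean (law K μ k) f]

theorem cesaro_apply (K : α → PMF α) (μ : PMF α) (n : ℕ) (t : α) :
    cesaro K μ n t =
      ((n + 1 : ℕ) : ℝ≥0∞)⁻¹ * ∑ k ∈ Finset.range (n + 1), law K μ k t := by
  classical
  simpa only [mean_pi_single] using mean_cesaro K μ n (Pi.single t 1)

theorem cesaro_bind_apply_le (K : α → PMF α) (μ : PMF α) (n : ℕ) (t : α) :
    (cesaro K μ n).bind K t ≤ cesaro K μ n t + ((n + 1 : ℕ) : ℝ≥0∞)⁻¹ := by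
  have hshift (k : ℕ) : mean (law K μ k) (fun s => K s t) = law K μ (k + 1) t :=
    (PMF.bind_apply ..).symm
  calc (cesaro K μ n).bind K t
      = mean (cesaro K μ n) fun s => K s t := PMF.bind_apply ..
    _ = ((n + 1 : ℕ) : ℝ≥0∞)⁻¹ * ∑ k ∈ Finset.range (n + 1), law K μ (k + 1) t := by
      simp only [mean_cesaro, hshift]
    _ ≤ ((n + 1 : ℕ) : ℝ≥0∞)⁻¹ * (∑ k ∈ Finset.range (n + 1), law K μ k t + 1) := by
      gcongr
      calc ∑ k ∈ Finset.range (n + 1), law K μ (k + 1) t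
          ≤ ∑ k ∈ Finset.range (n + 2), law K μ k t := by
            rw [Finset.sum_range_succ' _ (n + 1)]
            exact le_self_add
        _ ≤ ∑ k ∈ Finset.range (n + 1), law K μ k t + 1 := by
            rw [Finset.sum_range_succ _ (n + 1)]
            gcongr
            exact PMF.coe_le_one _ _
    _ = cesaro K μ n t + ((n + 1 : ℕ) : ℝ≥0∞)⁻¹ := by rw [cesaro_apply, mul_add, mul_one]

section Drift

variable {V W : α → ℝ≥0∞} {C : ℝ≥0∞}

theorem mean_bind_add_mean_le (hdrift : ∀ s, mean (K s) V + W s ≤ V s + C) (μ : PMF α) :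
    mean (μ.bind K) V + mean μ W ≤ mean μ V + C := by
  have := mean_mono μ hdrift
  rwa [mean_add, mean_add, mean_const, ← mean_bind] at this

theorem mean_le_of_stationary (hdrift : ∀ s, mean (K s) V + W s ≤ V s + C) {π : PMF α}
    (hπ : π.bind K = π) (hV : mean π V ≠ ∞) : mean π W ≤ C := by
  have := mean_bind_add_mean_le hdrift π
  rwa [hπ, ENNReal.add_le_add_iff_left hV] at this

theorem mean_law_add_sum_mean_law_le (hdrift : ∀ s, mean (K s) V + W s ≤ V s + C) (μ : PMF α)
    (n : ℕ) :
    mean (law K μ n) V + ∑ k ∈ Finset.range n, mean (law K μ k) W ≤ mean μ V + n * C := by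
  induction n with
  | zero => simp [law]
  | succ n ih =>
    calc mean (law K μ (n + 1)) V + ∑ k ∈ Finset.range (n + 1), mean (law K μ k) W
        = (mean ((law K μ n).bind K) V + mean (law K μ n) W) +
            ∑ k ∈ Finset.range n, mean (law K μ k) W := by
          rw [law, Finset.sum_range_succ]
          ring
      _ ≤ (mean (law K μ n) V + C) + ∑ k ∈ Finset.range n, mean (law K μ k) W :=
          add_le_add_left (mean_bind_add_mean_le hdrift (law K μ n)) _
      _ = (mean (law K μ n) V + ∑ k ∈ Finset.range n, mean (law K μ k) W) + C := by ring
      _ ≤ (mean μ V + n * C) + C := by gcongr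
      _ = mean μ V + (n + 1 : ℕ) * C := by push_cast; ring

theorem mean_cesaro_le (hdrift : ∀ s, mean (K s) V + W s ≤ V s + C) (μ : PMF α) (n : ℕ) :
    mean (cesaro K μ n) W ≤ ((n + 1 : ℕ) : ℝ≥0∞)⁻¹ * mean μ V + C :=
  calc mean (cesaro K μ n) W
      ≤ ((n + 1 : ℕ) : ℝ≥0∞)⁻¹ * (mean μ V + (n + 1 : ℕ) * C) := by
        rw [mean_cesaro]
        gcongr
        exact le_add_self.trans (mean_law_add_sum_mean_law_le hdrift μ (n + 1))
    _ = ((n + 1 : ℕ) : ℝ≥0∞)⁻¹ * mean μ V + C := by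
        rw [mul_add, ← mul_assoc, ENNReal.inv_mul_cancel (by simp) (by simp), one_mul]

end Drift

theorem tsum_mul_le_of_tendsto {ι : Type*} {l : Filter ι} [l.NeBot] {u : ι → α → ℝ≥0∞}
    {v : α → ℝ≥0∞} (hu : ∀ t, Filter.Tendsto (fun i => u i t) l (𝓝 (v t))) {f : α → ℝ≥0∞}
    (hf : ∀ t, f t ≠ ∞) {c : ι → ℝ≥0∞} {c₀ : ℝ≥0∞} (hc : Filter.Tendsto c l (𝓝 c₀))
    (hle : ∀ i, ∑' t, u i t * f t ≤ c i) : ∑' t, v t * f t ≤ c₀ := by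
  rw [ENNReal.tsum_eq_iSup_sum]
  refine iSup_le fun F => le_of_tendsto_of_tendsto' ?_ hc
    fun i => (ENNReal.sum_le_tsum F).trans (hle i)
  exact tendsto_finsetSum _ fun t _ => ENNReal.Tendsto.mul_const (hu t) (Or.inr (hf t))

theorem exists_tendsto_of_mean_le {ι : Type*} (𝒰 : Ultrafilter ι) {u : ι → PMF α}
    {W : α → ℝ≥0∞} (hW : ∀ N : ℕ, {s | W s ≤ N}.Finite) {M : ℝ≥0∞} (hM : M ≠ ∞)
    (hu : ∀ i, mean (u i) W ≤ M) :
    ∃ π : PMF α, ∀ t, Filter.Tendsto (fun i => u i t) 𝒰 (𝓝 (π t)) := by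
  obtain ⟨v, -, hv⟩ := (isCompact_univ (X := α → ℝ≥0∞)).ultrafilter_le_nhds
    (𝒰.map fun i => ⇑(u i)) (by simp)
  have hlim : ∀ t, Filter.Tendsto (fun i => u i t) 𝒰 (𝓝 (v t)) := tendsto_pi_nhds.1 hv
  have hmass_le : ∑' t, v t ≤ 1 := by
    simpa using tsum_mul_le_of_tendsto hlim (f := 1) (by simp) tendsto_const_nhds
      fun i => by simp
  have hmass_ge (N : ℕ) (hN : N ≠ 0) : 1 ≤ ∑' t, v t + M / N := by
    refine (ge_of_tendsto' ((tendsto_finsetSum (hW N).toFinset fun t _ => hlim t).add_const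
      (M / N)) fun i => ?_).trans (add_le_add_left (ENNReal.sum_le_tsum _) _)
    refine (one_le_sum_add_mean_div (u i) (by simpa using hN) (ENNReal.natCast_ne_top N)
      (F := (hW N).toFinset) fun s hs => ?_).trans (by gcongr; exact hu i)
    exact (not_le.1 (by simpa using hs)).le
  have hescape : Filter.Tendsto (fun N : ℕ => ∑' t, v t + M / N) Filter.atTop
      (𝓝 (∑' t, v t)) := by
    simpa using tendsto_const_nhds.add
      (ENNReal.Tendsto.const_div ENNReal.tendsto_nat_nhds_top (Or.inr hM))
  have hmass : ∑' t, v t = 1 := hmass_le.antisymm <|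
    ge_of_tendsto hescape ((Filter.eventually_ne_atTop 0).mono hmass_ge)
  exact ⟨⟨v, hmass ▸ ENNReal.summable.hasSum⟩, hlim⟩

/-- The Foster–Lyapunov criterion, by the Krylov–Bogoliubov argument: the drift condition makes the
time averages of the chain tight. -/
theorem exists_stationary_of_drift {V W : α → ℝ≥0∞} {C : ℝ≥0∞}
    (hdrift : ∀ s, mean (K s) V + W s ≤ V s + C) (hC : C ≠ ∞) {x : α} (hx : V x ≠ ∞)
    (hW : ∀ s, W s ≠ ∞) (hfin : ∀ N : ℕ, {s | W s ≤ N}.Finite) :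
    ∃ π : PMF α, π.bind K = π ∧ mean π W ≤ C := by
  set u := cesaro K (PMF.pure x)
  have hu (n : ℕ) : mean (u n) W ≤ ((n + 1 : ℕ) : ℝ≥0∞)⁻¹ * V x + C := by
    simpa only [mean_pure] using mean_cesaro_le hdrift (PMF.pure x) n
  have hbounded (n : ℕ) : mean (u n) W ≤ V x + C :=
    (hu n).trans (by gcongr; exact mul_le_of_le_one_left' (by simp))
  obtain ⟨π, hπ⟩ := exists_tendsto_of_mean_le (Filter.hyperfilter ℕ) hfin
    (ENNReal.add_ne_top.2 ⟨hx, hC⟩) hbounded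
  have hinv : Filter.Tendsto (fun n : ℕ => ((n + 1 : ℕ) : ℝ≥0∞)⁻¹) (Filter.hyperfilter ℕ)
      (𝓝 0) :=
    ((Filter.tendsto_add_atTop_iff_nat 1).2 ENNReal.tendsto_inv_nat_nhds_zero).mono_left
      Nat.hyperfilter_le_atTop
  refine ⟨π, pmf_eq_of_le fun t => ?_, ?_⟩
  · rw [PMF.bind_apply]
    exact tsum_mul_le_of_tendsto hπ (fun s => (K s).apply_ne_top t)
      (by simpa using (hπ t).add hinv) (cesaro_bind_apply_le K (PMF.pure x) · t)
  · refine tsum_mul_le_of_tendsto hπ hW ?_ hu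
    simpa using (ENNReal.Tendsto.mul_const hinv (Or.inr hx)).add_const C

end StationaryDistribution

section Coin

theorem ofReal_add_ofReal_symm (p : I) :
    ENNReal.ofReal p + ENNReal.ofReal (σ p) = 1 := by
  rw [← ENNReal.ofReal_add p.2.1 (σ p).2.1, unitInterval.coe_symm_eq]
  simp

theorem coin_true (p : I) : coin p true = ENNReal.ofReal p := by
  rw [ENNReal.ofReal, Real.toNNReal_of_nonneg p.2.1]
  rfl

theorem coin_false (p : I) : coin p false = ENNReal.ofReal (σ p) := by
  rw [ENNReal.ofReal, Real.toNNReal_of_nonneg (σ p).2.1]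
  rfl

theorem mean_coin (p : I) (f : Bool → ℝ≥0∞) :
    mean (coin p) f = ENNReal.ofReal p * f true + ENNReal.ofReal (σ p) * f false := by
  rw [mean, tsum_bool, coin_true, coin_false, add_comm]

theorem coin_bind_apply {α : Type*} (p : I) (κ : Bool → PMF α) (t : α) :
    (coin p).bind κ t = ENNReal.ofReal p * κ true t + ENNReal.ofReal (σ p) * κ false t := by
  rw [PMF.bind_apply]
  exact mean_coin p fun b => κ b t

theorem mean_coin_bind {α : Type*} (p : I) (κ : Bool → PMF α) (f : α → ℝ≥0∞) :
    mean ((coin p).bind κ) f =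
      ENNReal.ofReal p * mean (κ true) f + ENNReal.ofReal (σ p) * mean (κ false) f := by
  rw [mean_bind, mean_coin]

@[simp]
theorem someEdge_zero (p : I) : someEdge p 0 = 0 := by
  simp [someEdge]

theorem coe_someEdge (p : I) (n : ℕ) : (someEdge p n : ℝ) = 1 - (1 - (p : ℝ)) ^ n := by
  simp [someEdge]

theorem coe_symm_someEdge (p : I) (n : ℕ) : (σ (someEdge p n) : ℝ) = (1 - (p : ℝ)) ^ n := by
  simp [someEdge]

theorem someEdge_pos {p : I} (hp : 0 < p) {n : ℕ} (hn : n ≠ 0) : 0 < (someEdge p n : ℝ) := by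
  have hp' : (0 : ℝ) < p := hp
  rw [coe_someEdge, sub_pos]
  exact pow_lt_one₀ (sub_nonneg.2 p.2.2) (by linarith) hn

theorem someEdge_mul_le (p : I) {n : ℕ} {x y : ℝ≥0∞} (h : n ≠ 0 → x ≤ y) :
    ENNReal.ofReal (someEdge p n) * x ≤ ENNReal.ofReal (someEdge p n) * y := by
  rcases eq_or_ne n 0 with rfl | hn
  · simp
  · gcongr
    exact h hn

theorem someEdge_mul_congr (p : I) {n : ℕ} {x y : ℝ≥0∞} (h : n ≠ 0 → x = y) :
    ENNReal.ofReal (someEdge p n) * x = ENNReal.ofReal (someEdge p n) * y :=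
  le_antisymm (someEdge_mul_le p fun hn => (h hn).le) (someEdge_mul_le p fun hn => (h hn).ge)

end Coin

section ExpectedRun

/-- The expected number of matches in a run through a pool of `n` agents that goes on as long as
one of the remaining agents accepts the current item; each accepts with probability `p`. -/
noncomputable def expectedRun (p : I) : ℕ → ℝ
  | 0 => 0
  | n + 1 => someEdge p (n + 1) * (1 + expectedRun p n)

theorem expectedRun_nonneg (p : I) (n : ℕ) : 0 ≤ expectedRun p n := by
  induction n with
  | zero => exact le_rfl
  | succ n ih => exact mul_nonneg (someEdge p (n + 1)).2.1 (add_nonneg zero_le_one ih)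

theorem ofReal_expectedRun (p : I) (n : ℕ) :
    ENNReal.ofReal (expectedRun p n) =
      ENNReal.ofReal (someEdge p n) * (1 + ENNReal.ofReal (expectedRun p (n - 1))) := by
  cases n with
  | zero => simp [expectedRun]
  | succ n =>
    rw [expectedRun, ENNReal.ofReal_mul (someEdge p (n + 1)).2.1,
      ENNReal.ofReal_add zero_le_one (expectedRun_nonneg p n), ENNReal.ofReal_one,
      Nat.add_sub_cancel]

theorem one_sub_pow_mul_le_exp_neg (p : I) (y : ℝ) (n : ℕ) :
    (1 - (p : ℝ)) ^ n * (p * n - y + 1) ≤ Real.exp (-y) := by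
  have hq : 0 ≤ 1 - (p : ℝ) := sub_nonneg.2 p.2.2
  have hpow : (1 - (p : ℝ)) ^ n ≤ Real.exp (-(p * n)) :=
    calc (1 - (p : ℝ)) ^ n ≤ Real.exp (-p) ^ n := by
          gcongr
          exact Real.one_sub_le_exp_neg p
      _ = Real.exp (-(p * n)) := by rw [← Real.exp_nat_mul]; ring_nf
  calc (1 - (p : ℝ)) ^ n * (p * n - y + 1)
      ≤ (1 - (p : ℝ)) ^ n * Real.exp (p * n - y) := by
        gcongr
        exact Real.add_one_le_exp _
    _ ≤ Real.exp (-(p * n)) * Real.exp (p * n - y) := by gcongr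
    _ = Real.exp (-y) := by rw [← Real.exp_add]; ring_nf

/-- As `p → 0` with `p * n → x` the expected run tends to `exp x - 1`, and this becomes the bound
of that convex function by its tangent line at `x = y`. -/
theorem mul_le_expectedRun (p : I) (y : ℝ) (n : ℕ) :
    (p : ℝ) * n ≤ (Real.exp (-y) + p) * expectedRun p n + (y - 1 + Real.exp (-y)) := by
  induction n with
  | zero =>
    have := Real.add_one_le_exp (-y)
    simp only [expectedRun, Nat.cast_zero, mul_zero, zero_add]
    linarith
  | succ n ih =>
    have hpow := one_sub_pow_mul_le_exp_neg p y (n + 1)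
    have hrun := mul_le_mul_of_nonneg_left ih (someEdge p (n + 1)).2.1
    rw [expectedRun]
    rw [coe_someEdge] at hrun ⊢
    push_cast at hpow ⊢
    linarith

theorem natCast_le_mul_expectedRun {p : I} (hp : 0 < p) (n : ℕ) :
    (n : ℝ≥0∞) ≤ ENNReal.ofReal (2 / p) * ENNReal.ofReal (expectedRun p n) := by
  have hp' : (0 : ℝ) < p := hp
  have hrun := expectedRun_nonneg p n
  have htangent : (p : ℝ) * n ≤ (1 + p) * expectedRun p n := by simpa using mul_le_expectedRun p 0 n
  have hp_le : (1 + p) * expectedRun p n ≤ 2 * expectedRun p n := by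
    gcongr
    linarith [p.2.2]
  rw [← ENNReal.ofReal_mul (by positivity), ← ENNReal.ofReal_natCast]
  gcongr
  rw [div_mul_eq_mul_div, le_div_iff₀ hp', mul_comm]
  exact htangent.trans hp_le

end ExpectedRun

section ChainSegment

variable {pH pE : I}

theorem pool_induction {P : ℕ → ℕ → Prop}
    (step : ∀ h e, (h ≠ 0 → P (h - 1) e) → (e ≠ 0 → P h (e - 1)) → P h e) : ∀ h e, P h e
  | h, e => step h e (fun _ => pool_induction step (h - 1) e) fun _ => pool_induction step h (e - 1)
termination_by h e => h + e

theorem mean_chainSegment (h e : ℕ) (f : ℕ × ℕ → ℝ≥0∞) :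
    mean (chainSegment pH pE h e) f =
      ENNReal.ofReal (someEdge pH h) * mean (chainSegment pH pE (h - 1) e) f +
        ENNReal.ofReal (σ (someEdge pH h)) *
          (ENNReal.ofReal (someEdge pE e) * mean (chainSegment pH pE h (e - 1)) f +
            ENNReal.ofReal (σ (someEdge pE e)) * f (h, e)) := by
  conv_lhs => rw [chainSegment, mean_coin_bind]
  congr 1
  · exact someEdge_mul_congr pH fun hh => by simp [Nat.pos_of_ne_zero hh]
  · simp only [Bool.false_eq_true, false_and, dite_false]
    rw [mean_coin_bind]
    congr 2
    · exact someEdge_mul_congr pE fun he => by simp [Nat.pos_of_ne_zero he]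
    · simp [mean_pure]

theorem chainSegment_zero_ne_zero (hpH : 0 < pH) (hpE : 0 < pE) (h e : ℕ) :
    chainSegment pH pE h e (0, 0) ≠ 0 := by
  rw [← mean_pi_single]
  induction h, e using pool_induction with | step h e ihH ihE =>
  rw [mean_chainSegment]
  rcases eq_or_ne h 0 with rfl | hh
  · rcases eq_or_ne e 0 with rfl | he
    · simp
    · simp [someEdge_pos hpE he, ihE he]
  · simp [someEdge_pos hpH hh, ihH hh]

theorem natCast_sub_one_add_one {n : ℕ} (hn : n ≠ 0) : ((n - 1 : ℕ) : ℝ≥0∞) + 1 = n := by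
  exact_mod_cast congrArg (Nat.cast : ℕ → ℝ≥0∞) (Nat.sub_one_add_one hn)

theorem mean_fst_chainSegment_add_le (h e : ℕ) :
    (mean (chainSegment pH pE h e) fun t => t.1) + ENNReal.ofReal (expectedRun pH h) ≤ h := by
  induction h, e using pool_induction with | step h e ihH ihE =>
  rw [mean_chainSegment, ofReal_expectedRun]
  set A := ENNReal.ofReal (someEdge pH h)
  set A' := ENNReal.ofReal (σ (someEdge pH h))
  set B := ENNReal.ofReal (someEdge pE e)
  set B' := ENNReal.ofReal (σ (someEdge pE e))
  set R := ENNReal.ofReal (expectedRun pH (h - 1))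
  have hmatchH : A * ((mean (chainSegment pH pE (h - 1) e) fun t => t.1) + R + 1) ≤ A * h :=
    someEdge_mul_le pH fun hh =>
      (add_le_add_left (ihH hh) 1).trans_eq (natCast_sub_one_add_one hh)
  have hmatchE : B * (mean (chainSegment pH pE h (e - 1)) fun t => t.1) ≤ B * h :=
    someEdge_mul_le pE fun he => le_self_add.trans (ihE he)
  calc _ = A * ((mean (chainSegment pH pE (h - 1) e) fun t => t.1) + R + 1) +
        A' * (B * (mean (chainSegment pH pE h (e - 1)) fun t => t.1) + B' * h) := by ring
    _ ≤ A * h + A' * (B * h + B' * h) := by gcongr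
    _ = h := by
      rw [← add_mul B, ofReal_add_ofReal_symm, one_mul, ← add_mul, ofReal_add_ofReal_symm,
        one_mul]

theorem mean_snd_chainSegment_add_le (h e : ℕ) :
    (mean (chainSegment pH pE h e) fun t => t.2) + ENNReal.ofReal (expectedRun pE e) ≤ e := by
  induction h, e using pool_induction with | step h e ihH ihE =>
  rw [mean_chainSegment]
  set A := ENNReal.ofReal (someEdge pH h)
  set A' := ENNReal.ofReal (σ (someEdge pH h))
  set B := ENNReal.ofReal (someEdge pE e)
  set B' := ENNReal.ofReal (σ (someEdge pE e))
  set R := ENNReal.ofReal (expectedRun pE (e - 1))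
  have hrun : ENNReal.ofReal (expectedRun pE e) = B * (1 + R) := ofReal_expectedRun pE e
  have hcoin : B * (1 + R) = A * (B * (1 + R)) + A' * (B * (1 + R)) := by
    rw [← add_mul, ofReal_add_ofReal_symm, one_mul]
  have hmatchH : A * ((mean (chainSegment pH pE (h - 1) e) fun t => t.2) + B * (1 + R)) ≤ A * e :=
    someEdge_mul_le pH fun hh => hrun ▸ ihH hh
  have hmatchE : B * ((mean (chainSegment pH pE h (e - 1)) fun t => t.2) + R + 1) ≤ B * e :=
    someEdge_mul_le pE fun he =>
      (add_le_add_left (ihE he) 1).trans_eq (natCast_sub_one_add_one he)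
  calc _ = A * ((mean (chainSegment pH pE (h - 1) e) fun t => t.2) + B * (1 + R)) +
        A' * (B * ((mean (chainSegment pH pE h (e - 1)) fun t => t.2) + R + 1) + B' * e) := by
        conv_lhs => rw [hrun, hcoin]
        ring
    _ ≤ A * e + A' * (B * e + B' * e) := by gcongr
    _ = e := by
      rw [← add_mul B, ofReal_add_ofReal_symm, one_mul, ← add_mul, ofReal_add_ofReal_symm,
        one_mul]

theorem mean_taggedSegment (h e : ℕ) (g : Option (ℕ × ℕ) → ℝ≥0∞) :
    mean (taggedSegment pH pE h e) g =
      ENNReal.ofReal (someEdge pH (h + 1)) *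
          ((h + 1 : ℝ≥0∞)⁻¹ * (g none + h * mean (taggedSegment pH pE (h - 1) e) g)) +
        ENNReal.ofReal (σ (someEdge pH (h + 1))) *
          (ENNReal.ofReal (someEdge pE e) * mean (taggedSegment pH pE h (e - 1)) g +
            ENNReal.ofReal (σ (someEdge pE e)) * g (some (h, e))) := by
  conv_lhs => rw [taggedSegment, mean_coin_bind]
  simp only [if_true, Bool.false_eq_true, if_false]
  congr 2
  · rw [mean_bind, mean_uniformOfFintype, Fin.sum_univ_succ]
    rcases eq_or_ne h 0 with rfl | hh
    · simp [mean_pure]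
    · simp [mean_pure, hh, Fin.succ_ne_zero]
  · rw [mean_coin_bind]
    congr 1
    · exact someEdge_mul_congr pE fun he => by simp [Nat.pos_of_ne_zero he]
    · simp [mean_pure]

/-- The agents being exchangeable, summing over the survivors of a segment is the same as summing,
over the agents present at its start, the contribution of each on the event that she survives. -/
theorem mean_chainSegment_mul_eq (f : ℕ × ℕ → ℝ≥0∞) (h e : ℕ) :
    (mean (chainSegment pH pE h e) fun t => t.1 * f (t.1 - 1, t.2)) =
      h * mean (taggedSegment pH pE (h - 1) e) fun o => o.elim 0 f := by
  induction h, e using pool_induction with | step h e ihH ihE =>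
  rw [mean_chainSegment, someEdge_mul_congr pH ihH, someEdge_mul_congr pE ihE]
  cases h with
  | zero => simp
  | succ h =>
    rw [Nat.add_sub_cancel, mean_taggedSegment h e]
    simp only [Option.elim_none, Option.elim_some, zero_add, Nat.cast_add_one, mul_add]
    have hinv : (h + 1 : ℝ≥0∞) * (h + 1 : ℝ≥0∞)⁻¹ = 1 := ENNReal.mul_inv_cancel (by simp) (by simp)
    congr 1
    · conv_lhs => rw [← one_mul (_ * _), ← hinv]
      ring
    · ring

end ChainSegment

section Step

variable {a pH pE : I} {d : ℕ}

/-- The state after the next arrival, which is of type `H` with probability `a`. -/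
noncomputable def step (a pH pE : I) (d : ℕ) (s : ℕ × ℕ) : PMF (ℕ × ℕ) :=
  (coin a).bind fun b => if b then arriveH pH pE d s else arriveE pH pE d s

/-- What the next arrival does to a tagged waiting `H` agent and to the others. -/
noncomputable def taggedStep (a pH pE : I) (d : ℕ) (s : ℕ × ℕ) : PMF (Option (ℕ × ℕ)) :=
  (coin a).bind fun b => if b then taggedArriveH pH pE d s else taggedArriveE pH pE d s

/-- The probability that the next arrival is an `E` agent who starts a chain-segment. -/
def startE (a pE : I) (d : ℕ) : I := σ a * someEdge pE d

theorem startE_pos (ha : a < 1) (hpE : 0 < pE) (hd : d ≠ 0) : 0 < (startE a pE d : ℝ) :=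
  mul_pos (sub_pos.2 ha) (someEdge_pos hpE hd)

theorem mean_step (s : ℕ × ℕ) (f : ℕ × ℕ → ℝ≥0∞) :
    mean (step a pH pE d s) f =
      ENNReal.ofReal a *
          (ENNReal.ofReal (someEdge pH d) * mean (chainSegment pH pE s.1 s.2) f +
            ENNReal.ofReal (σ (someEdge pH d)) * f (s.1 + 1, s.2)) +
        ENNReal.ofReal (σ a) *
          (ENNReal.ofReal (someEdge pE d) * mean (chainSegment pH pE s.1 s.2) f +
            ENNReal.ofReal (σ (someEdge pE d)) * f (s.1, s.2 + 1)) := by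
  simp [step, arriveH, arriveE, mean_coin_bind, mean_pure]

theorem mean_taggedStep (s : ℕ × ℕ) (g : Option (ℕ × ℕ) → ℝ≥0∞) :
    mean (taggedStep a pH pE d s) g =
      ENNReal.ofReal a *
          (ENNReal.ofReal (someEdge pH d) * mean (taggedSegment pH pE s.1 s.2) g +
            ENNReal.ofReal (σ (someEdge pH d)) * g (some (s.1 + 1, s.2))) +
        ENNReal.ofReal (σ a) *
          (ENNReal.ofReal (someEdge pE d) * mean (taggedSegment pH pE s.1 s.2) g +
            ENNReal.ofReal (σ (someEdge pE d)) * g (some (s.1, s.2 + 1))) := by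
  simp [taggedStep, taggedArriveH, taggedArriveE, mean_coin_bind, mean_pure]

theorem step_zero_ne_zero (ha : a < 1) (hpH : 0 < pH) (hpE : 0 < pE) (hd : d ≠ 0) (s : ℕ × ℕ) :
    step a pH pE d s (0, 0) ≠ 0 := by
  have hsegment := chainSegment_zero_ne_zero hpH hpE s.1 s.2
  have ha' : 0 < (σ a : ℝ) := sub_pos.2 ha
  rw [← mean_pi_single] at hsegment ⊢
  rw [mean_step, mul_add (ENNReal.ofReal (σ a))]
  simp [-unitInterval.coe_symm_eq, ha', someEdge_pos hpE hd, hsegment]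

theorem mean_step_add_le {f : ℕ × ℕ → ℝ≥0∞} (hf : Monotone f) {s : ℕ × ℕ} {r : ℝ≥0∞}
    (hr : mean (chainSegment pH pE s.1 s.2) f + r ≤ f s) :
    mean (step a pH pE d s) f + ENNReal.ofReal (startE a pE d) * r ≤
      ENNReal.ofReal a * f (s.1 + 1, s.2) + ENNReal.ofReal (σ a) * f (s.1, s.2 + 1) := by
  have hH : mean (chainSegment pH pE s.1 s.2) f ≤ f (s.1 + 1, s.2) :=
    (le_self_add.trans hr).trans (hf ⟨Nat.le_succ _, le_rfl⟩)
  have hE : mean (chainSegment pH pE s.1 s.2) f + r ≤ f (s.1, s.2 + 1) :=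
    hr.trans (hf ⟨le_rfl, Nat.le_succ _⟩)
  have hstart : ENNReal.ofReal (startE a pE d) =
      ENNReal.ofReal (σ a) * ENNReal.ofReal (someEdge pE d) := ENNReal.ofReal_mul (σ a).2.1
  calc _ = ENNReal.ofReal a *
          (ENNReal.ofReal (someEdge pH d) * mean (chainSegment pH pE s.1 s.2) f +
            ENNReal.ofReal (σ (someEdge pH d)) * f (s.1 + 1, s.2)) +
        ENNReal.ofReal (σ a) *
          (ENNReal.ofReal (someEdge pE d) * (mean (chainSegment pH pE s.1 s.2) f + r) +
            ENNReal.ofReal (σ (someEdge pE d)) * f (s.1, s.2 + 1)) := by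
        rw [mean_step, hstart]
        ring
    _ ≤ ENNReal.ofReal a *
          (ENNReal.ofReal (someEdge pH d) * f (s.1 + 1, s.2) +
            ENNReal.ofReal (σ (someEdge pH d)) * f (s.1 + 1, s.2)) +
        ENNReal.ofReal (σ a) *
          (ENNReal.ofReal (someEdge pE d) * f (s.1, s.2 + 1) +
            ENNReal.ofReal (σ (someEdge pE d)) * f (s.1, s.2 + 1)) := by gcongr
    _ = _ := by simp only [← add_mul, ofReal_add_ofReal_symm, one_mul]

theorem mean_fst_step_add_le (s : ℕ × ℕ) :
    (mean (step a pH pE d s) fun t => t.1) +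
      ENNReal.ofReal (startE a pE d) * ENNReal.ofReal (expectedRun pH s.1) ≤
        s.1 + ENNReal.ofReal a := by
  refine (mean_step_add_le (fun s t hst => Nat.cast_le.2 hst.1)
    (mean_fst_chainSegment_add_le s.1 s.2)).trans_eq ?_
  push_cast
  rw [mul_add, mul_one, add_right_comm, ← add_mul, ofReal_add_ofReal_symm, one_mul]

theorem mean_snd_step_add_le (s : ℕ × ℕ) :
    (mean (step a pH pE d s) fun t => t.2) +
      ENNReal.ofReal (startE a pE d) * ENNReal.ofReal (expectedRun pE s.2) ≤
        s.2 + ENNReal.ofReal (σ a) := by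
  refine (mean_step_add_le (fun s t hst => Nat.cast_le.2 hst.2)
    (mean_snd_chainSegment_add_le s.1 s.2)).trans_eq ?_
  push_cast
  rw [mul_add, mul_one, ← add_assoc, ← add_mul, ofReal_add_ofReal_symm, one_mul]

theorem mean_add_step_add_le (s : ℕ × ℕ) :
    (mean (step a pH pE d s) fun t => t.1 + t.2) + ENNReal.ofReal (startE a pE d) *
      (ENNReal.ofReal (expectedRun pH s.1) + ENNReal.ofReal (expectedRun pE s.2)) ≤
        s.1 + s.2 + 1 := by
  rw [mean_add, mul_add, add_add_add_comm, ← ofReal_add_ofReal_symm a,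
    add_add_add_comm (s.1 : ℝ≥0∞)]
  exact add_le_add (mean_fst_step_add_le s) (mean_snd_step_add_le s)

theorem add_le_mul_expectedRun_add (hpH : 0 < pH) (hpE : 0 < pE) (h e : ℕ) :
    (h + e : ℝ≥0∞) ≤ (ENNReal.ofReal (2 / pH) + ENNReal.ofReal (2 / pE)) *
      (ENNReal.ofReal (expectedRun pH h) + ENNReal.ofReal (expectedRun pE e)) :=
  calc (h + e : ℝ≥0∞)
      ≤ ENNReal.ofReal (2 / pH) * ENNReal.ofReal (expectedRun pH h) +
          ENNReal.ofReal (2 / pE) * ENNReal.ofReal (expectedRun pE e) :=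
        add_le_add (natCast_le_mul_expectedRun hpH h) (natCast_le_mul_expectedRun hpE e)
    _ ≤ _ := by
        rw [mul_add]
        gcongr
        · exact le_self_add
        · exact le_add_self

theorem exists_stationary_step (ha : a < 1) (hpH : 0 < pH) (hpE : 0 < pE) (hd : d ≠ 0) :
    ∃ π : PMF (ℕ × ℕ), π.bind (step a pH pE d) = π ∧ (mean π fun s => s.1) ≠ ∞ := by
  set c := ENNReal.ofReal (startE a pE d)
  set D := ENNReal.ofReal (2 / pH) + ENNReal.ofReal (2 / pE)
  have hc : c ≠ 0 := (ENNReal.ofReal_pos.2 (startE_pos ha hpE hd)).ne'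
  set B := D / c
  have hB : B ≠ ∞ := ENNReal.div_ne_top (by simp [D]) hc
  have hBc : B * c = D := ENNReal.div_mul_cancel hc ENNReal.ofReal_ne_top
  have hdrift (s : ℕ × ℕ) :
      (mean (step a pH pE d s) fun t => B * (t.1 + t.2)) + (s.1 + s.2 : ℝ≥0∞) ≤
        B * (s.1 + s.2) + B := by
    have hlower : (s.1 + s.2 : ℝ≥0∞) ≤ B * (c *
        (ENNReal.ofReal (expectedRun pH s.1) + ENNReal.ofReal (expectedRun pE s.2))) := by
      rw [← mul_assoc, hBc]
      exact add_le_mul_expectedRun_add hpH hpE s.1 s.2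
    rw [mean_const_mul]
    refine (add_le_add_right hlower _).trans ?_
    rw [← mul_add, ← mul_add_one]
    exact mul_le_mul_right (mean_add_step_add_le s) B
  have hfin (N : ℕ) : {s : ℕ × ℕ | (s.1 + s.2 : ℝ≥0∞) ≤ N}.Finite := by
    refine (Set.finite_Iic (N, N)).subset fun s hs => ?_
    have : s.1 + s.2 ≤ N := by exact_mod_cast hs
    exact ⟨by omega, by omega⟩
  obtain ⟨π, hπ, hmean⟩ := exists_stationary_of_drift hdrift hB (x := (0, 0)) (by simp)
    (by finiteness) hfin
  exact ⟨π, hπ, ne_top_of_le_ne_top hB ((mean_mono π fun s => le_self_add).trans hmean)⟩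

/-- In the steady state the expected run, hence an exponential moment of the number of waiting `H`
agents, is bounded; Jensen's inequality, in the form of the tangent line at `y = log (L + 1)`,
turns this into a bound on their mean number. -/
theorem mul_mean_fst_le {π : PMF (ℕ × ℕ)} (hc : 0 < (startE a pE d : ℝ))
    (hπ : π.bind (step a pH pE d) = π) (hfin : (mean π fun s => s.1) ≠ ∞) :
    ENNReal.ofReal pH * (mean π fun s => s.1) ≤
      ENNReal.ofReal (Real.log (a / startE a pE d + 1) + pH * (a / startE a pE d)) := by
  set L : ℝ := a / startE a pE d
  set y : ℝ := Real.log (L + 1)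
  have hL : 0 ≤ L := div_nonneg a.2.1 hc.le
  have hexp : Real.exp (-y) = (L + 1)⁻¹ := by rw [Real.exp_neg, Real.exp_log (by positivity)]
  have hrest : 0 ≤ y - 1 + Real.exp (-y) := by linarith [Real.add_one_le_exp (-y)]
  have hcoef : 0 ≤ Real.exp (-y) + pH := add_nonneg (Real.exp_nonneg _) pH.2.1
  have hrun : (mean π fun s => ENNReal.ofReal (expectedRun pH s.1)) ≤ ENNReal.ofReal L := by
    rw [ENNReal.ofReal_div_of_pos hc, ENNReal.le_div_iff_mul_le (by simp [hc]) (by simp), mul_comm,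
      ← mean_const_mul]
    exact mean_le_of_stationary mean_fst_step_add_le hπ hfin
  have htangent (n : ℕ) : ENNReal.ofReal pH * n ≤
      ENNReal.ofReal (Real.exp (-y) + pH) * ENNReal.ofReal (expectedRun pH n) +
        ENNReal.ofReal (y - 1 + Real.exp (-y)) := by
    rw [← ENNReal.ofReal_natCast, ← ENNReal.ofReal_mul pH.2.1, ← ENNReal.ofReal_mul hcoef,
      ← ENNReal.ofReal_add (mul_nonneg hcoef (expectedRun_nonneg pH n)) hrest]
    exact ENNReal.ofReal_le_ofReal (mul_le_expectedRun pH y n)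
  calc ENNReal.ofReal pH * (mean π fun s => s.1)
      ≤ ENNReal.ofReal (Real.exp (-y) + pH) * (mean π fun s => ENNReal.ofReal (expectedRun pH s.1))
          + ENNReal.ofReal (y - 1 + Real.exp (-y)) := by
        rw [← mean_const_mul, ← mean_const_mul]
        simpa only [mean_add, mean_const] using mean_mono π fun s => htangent s.1
    _ ≤ ENNReal.ofReal (Real.exp (-y) + pH) * ENNReal.ofReal L
          + ENNReal.ofReal (y - 1 + Real.exp (-y)) := by gcongr
    _ = ENNReal.ofReal (y + pH * L) := by
        rw [← ENNReal.ofReal_mul hcoef, ← ENNReal.ofReal_add (mul_nonneg hcoef hL) hrest, hexp]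
        congr 1
        field_simp
        ring

end Step

section WaitingTime

variable {a pH pE : I} {d : ℕ} {π : PMF (ℕ × ℕ)}

theorem mean_step_mul_eq (s : ℕ × ℕ) (f : ℕ × ℕ → ℝ≥0∞) :
    (mean (step a pH pE d s) fun t => t.1 * f (t.1 - 1, t.2)) =
      ENNReal.ofReal a * ENNReal.ofReal (σ (someEdge pH d)) * f s +
        s.1 * mean (taggedStep a pH pE d (s.1 - 1, s.2)) fun o => o.elim 0 f := by
  have hjoin : (s.1 : ℝ≥0∞) * f (s.1 - 1 + 1, s.2) = s.1 * f s := by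
    rcases eq_or_ne s.1 0 with hs | hs
    · simp [hs]
    · rw [Nat.sub_one_add_one hs]
  rw [mean_step, mean_taggedStep, mean_chainSegment_mul_eq]
  simp only [Option.elim_some, Nat.add_sub_cancel, Nat.cast_add_one, Prod.mk.eta]
  rw [mul_add (s.1 : ℝ≥0∞), mul_left_comm (s.1 : ℝ≥0∞) (ENNReal.ofReal a), mul_add (s.1 : ℝ≥0∞),
    mul_left_comm (s.1 : ℝ≥0∞) (ENNReal.ofReal (σ (someEdge pH d))), hjoin]
  ring

theorem mean_mul_eq_of_stationary (hπ : π.bind (step a pH pE d) = π)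
    (f : ℕ × ℕ → ℝ≥0∞) :
    (mean π fun s => s.1 * f (s.1 - 1, s.2)) =
      ENNReal.ofReal a * ENNReal.ofReal (σ (someEdge pH d)) * mean π f +
        mean π fun s => s.1 * mean (taggedStep a pH pE d (s.1 - 1, s.2)) fun o => o.elim 0 f := by
  conv_lhs => rw [← hπ, mean_bind]
  simp only [mean_step_mul_eq, mean_add, mean_const_mul]

variable {lamH lamE : ℝ}

/-- The probability that an arriving agent is of type `H`. -/
noncomputable def shareH (hH : 0 < lamH) (hE : 0 < lamE) : I :=
  ⟨lamH / (lamH + lamE), by positivity, div_le_one_of_le₀ (by linarith) (by positivity)⟩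

theorem coe_symm_shareH (hH : 0 < lamH) (hE : 0 < lamE) :
    (σ (shareH hH hE) : ℝ) = lamE / (lamH + lamE) := by
  rw [unitInterval.coe_symm_eq, shareH]
  field_simp
  ring

theorem shareH_lt_one (hH : 0 < lamH) (hE : 0 < lamE) : shareH hH hE < 1 :=
  Subtype.coe_lt_coe.1 ((div_lt_one (add_pos hH hE)).2 (by simpa using hE))

theorem isSteadyState_iff (hH : 0 < lamH) (hE : 0 < lamE) :
    IsSteadyState lamH lamE pH pE d π ↔ π.bind (step (shareH hH hE) pH pE d) = π := by
  have hsum : 0 < lamH + lamE := add_pos hH hE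
  have hH' : ENNReal.ofReal lamH =
      ENNReal.ofReal (lamH + lamE) * ENNReal.ofReal (shareH hH hE) := by
    rw [← ENNReal.ofReal_mul hsum.le, shareH, mul_div_cancel₀ _ hsum.ne']
  have hE' : ENNReal.ofReal lamE =
      ENNReal.ofReal (lamH + lamE) * ENNReal.ofReal (σ (shareH hH hE)) := by
    rw [← ENNReal.ofReal_mul hsum.le, coe_symm_shareH, mul_div_cancel₀ _ hsum.ne']
  have hrate (s t : ℕ × ℕ) : rate lamH lamE pH pE d s t =
      ENNReal.ofReal (lamH + lamE) * step (shareH hH hE) pH pE d s t := by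
    rw [rate, hH', hE', step, coin_bind_apply]
    simp only [if_true, Bool.false_eq_true, if_false]
    ring
  simp only [IsSteadyState, hrate, mul_left_comm _ (ENNReal.ofReal (lamH + lamE)),
    ENNReal.tsum_mul_left, PMF.ext_iff, PMF.bind_apply,
    ENNReal.mul_right_inj (ENNReal.ofReal_pos.2 hsum).ne' ENNReal.ofReal_ne_top]

theorem stillWaiting_succ (hH : 0 < lamH) (hE : 0 < lamE) (n : ℕ) (s : ℕ × ℕ) :
    stillWaiting lamH lamE pH pE d (n + 1) s =
      mean (taggedStep (shareH hH hE) pH pE d s) fun o =>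
        o.elim 0 (stillWaiting lamH lamE pH pE d n) := by
  simp only [mean_option_elim, stillWaiting, taggedStep, coin_bind_apply, coe_symm_shareH, if_true,
    Bool.false_eq_true, if_false]
  rfl

theorem sum_mean_stillWaiting_add (hH : 0 < lamH) (hE : 0 < lamE)
    (hπ : IsSteadyState lamH lamE pH pE d π) (n : ℕ) :
    ENNReal.ofReal (shareH hH hE) * ENNReal.ofReal (σ (someEdge pH d)) *
        ∑ k ∈ Finset.range n, mean π (stillWaiting lamH lamE pH pE d k) +
      (mean π fun s => s.1 * stillWaiting lamH lamE pH pE d n (s.1 - 1, s.2)) =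
        mean π fun s => s.1 := by
  induction n with
  | zero => simp [stillWaiting]
  | succ n ih =>
    rw [Finset.sum_range_succ, mul_add, add_assoc, ← ih,
      mean_mul_eq_of_stationary ((isSteadyState_iff hH hE).1 hπ)
        (stillWaiting lamH lamE pH pE d n)]
    simp only [stillWaiting_succ hH hE]

/-- Little's law. The gap between the two sides is the limiting mean number of waiting agents that
survive `n` arrivals, so this inequality does not require that every agent is eventually matched. -/
theorem mul_waitH_le_mean_fst (hH : 0 < lamH) (hE : 0 < lamE)
    (hπ : IsSteadyState lamH lamE pH pE d π) :
    ENNReal.ofReal lamH * waitH lamH lamE pH pE d π ≤ mean π fun s => s.1 := by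
  have hwait : ENNReal.ofReal lamH * waitH lamH lamE pH pE d π =
      ENNReal.ofReal (shareH hH hE) * ENNReal.ofReal (σ (someEdge pH d)) *
        ∑' n, mean π (stillWaiting lamH lamE pH pE d n) := by
    have hshare : ENNReal.ofReal (shareH hH hE) =
        ENNReal.ofReal lamH / ENNReal.ofReal (lamH + lamE) :=
      ENNReal.ofReal_div_of_pos (add_pos hH hE)
    have hmean : waitH lamH lamE pH pE d π = mean π fun s =>
        ENNReal.ofReal ((1 - (pH : ℝ)) ^ d) * (ENNReal.ofReal (lamH + lamE))⁻¹ *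
          ∑' n, stillWaiting lamH lamE pH pE d n s := by
      simp only [waitH, meanRemainingWait, mean, div_eq_mul_inv]
      exact tsum_congr fun s => by ring
    rw [hmean, mean_const_mul, mean_tsum, hshare, coe_symm_someEdge, div_eq_mul_inv]
    ring
  rw [hwait, ENNReal.tsum_eq_iSup_nat, ENNReal.mul_iSup]
  exact iSup_le fun n => le_self_add.trans (sum_mean_stillWaiting_add hH hE hπ n).le

theorem existsUnique_isSteadyState (hH : 0 < lamH) (hE : 0 < lamE) (hpH : 0 < pH) (hpE : 0 < pE)
    (hd : d ≠ 0) : ∃! π, IsSteadyState lamH lamE pH pE d π := by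
  have ha := shareH_lt_one hH hE
  simp only [isSteadyState_iff hH hE]
  obtain ⟨π, hπ, -⟩ := exists_stationary_step ha hpH hpE hd
  exact ⟨π, hπ, fun ν hν => stationary_unique (step_zero_ne_zero ha hpH hpE hd) hν hπ⟩

theorem shareH_div_startE (hH : 0 < lamH) (hE : 0 < lamE) :
    (shareH hH hE / startE (shareH hH hE) pE d : ℝ) = lamH / (lamE * (1 - (1 - (pE : ℝ)) ^ d)) := by
  have hsum : lamH + lamE ≠ 0 := (add_pos hH hE).ne'
  rw [startE, Set.Icc.coe_mul, coe_symm_shareH, coe_someEdge, div_mul_eq_mul_div]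
  exact div_div_div_cancel_right₀ hsum _ _

theorem mul_waitH_le (hH : 0 < lamH) (hE : 0 < lamE) (hpH : 0 < pH) (hpE : 0 < pE) (hd : d ≠ 0)
    (hπ : IsSteadyState lamH lamE pH pE d π) :
    ENNReal.ofReal pH * waitH lamH lamE pH pE d π ≤
      ENNReal.ofReal ((Real.log (lamH / (lamE * (1 - (1 - (pE : ℝ)) ^ d)) + 1) +
        pH * (lamH / (lamE * (1 - (1 - (pE : ℝ)) ^ d)))) / lamH) := by
  have ha := shareH_lt_one hH hE
  have hπ' := (isSteadyState_iff hH hE).1 hπ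
  obtain ⟨ν, hν, hfin⟩ := exists_stationary_step ha hpH hpE hd
  obtain rfl := stationary_unique (step_zero_ne_zero ha hpH hpE hd) hπ' hν
  rw [← shareH_div_startE hH hE, ENNReal.ofReal_div_of_pos hH,
    ENNReal.le_div_iff_mul_le (by simp [hH]) (by simp), mul_assoc, mul_comm (waitH ..)]
  calc _ ≤ ENNReal.ofReal pH * (mean π fun s => s.1) := by
        gcongr
        exact mul_waitH_le_mean_fst hH hE hπ
    _ ≤ _ := mul_mean_fst_le (startE_pos ha hpE hd) hν hfin

end WaitingTime

end ChainMatching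

theorem theorem3 (lamH lamE : ℝ) (hH : 0 < lamH) (hE : 0 < lamE) (pE : I) (hpE : 0 < pE)
    (d : ℕ) (hd : 1 ≤ d) :
    ∃ π : I → PMF (ℕ × ℕ),
      (∀ pH : I, 0 < pH →
        ChainMatching.IsSteadyState lamH lamE pH pE d (π pH) ∧
          ∀ ν : PMF (ℕ × ℕ), ChainMatching.IsSteadyState lamH lamE pH pE d ν → ν = π pH) ∧
      Filter.limsup
          (fun pH : I =>
            ENNReal.ofReal (pH : ℝ) * ChainMatching.waitH lamH lamE pH pE d (π pH))
          (𝓝[>] (0 : I)) ≤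
        ENNReal.ofReal (Real.log (lamH / (lamE * (1 - (1 - (pE : ℝ)) ^ d)) + 1) / lamH) := by
  have hd₀ : d ≠ 0 := Nat.one_le_iff_ne_zero.1 hd
  choose! π hπ using fun (pH : I) (hpH : 0 < pH) =>
    ChainMatching.existsUnique_isSteadyState hH hE hpH hpE hd₀
  refine ⟨π, hπ, ?_⟩
  set L : ℝ := lamH / (lamE * (1 - (1 - (pE : ℝ)) ^ d))
  have hbound : ∀ᶠ pH : I in 𝓝[>] 0,
      ENNReal.ofReal (pH : ℝ) * ChainMatching.waitH lamH lamE pH pE d (π pH) ≤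
        ENNReal.ofReal ((Real.log (L + 1) + pH * L) / lamH) := by
    filter_upwards [self_mem_nhdsWithin] with pH hpH
    exact ChainMatching.mul_waitH_le hH hE hpH hpE hd₀ (hπ pH hpH).1
  have hlim : Filter.Tendsto (fun pH : I => ENNReal.ofReal ((Real.log (L + 1) + pH * L) / lamH))
      (𝓝[>] 0) (𝓝 (ENNReal.ofReal (Real.log (L + 1) / lamH))) := by
    have hcont : Continuous fun pH : I => ENNReal.ofReal ((Real.log (L + 1) + pH * L) / lamH) :=
      ENNReal.continuous_ofReal.comp (by fun_prop)
    simpa using (hcont.tendsto 0).mono_left nhdsWithin_le_nhds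
  have : (𝓝[>] (0 : I)).NeBot := nhdsGT_neBot_of_exists_gt ⟨1, zero_lt_one⟩
  exact (Filter.limsup_le_limsup hbound).trans hlim.limsup_eq.le
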